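/- Let $n,a,b,t$ be integers with $t\ge 1$, $b\ge 2$, $a\ge b+t-1$ and $n\ge\max\{a+b,\,bt\}$. Write $[n]=\{1,\dots,n\}$ and let $\binom{[n]}{k}$ be the collection of all $k$-element subsets of $[n]$. For a family $\mathcal H$ of non-empty subsets of $[n]$, let the covering number $\tau(\mathcal H)$ be the minimum of $|T|$ over all $T\subseteq[n]$ with $T\cap H\neq\emptyset$ for every $H\in\mathcal H$. Let $\mathcal F\subseteq\binom{[n]}{a}$ and $\mathcal G\subseteq\binom{[n]}{b}$ be cross-intersecting, that is, $F\cap G\ne\emptyset$ for all $F\in\mathcal F$ and $G\in\mathcal G$, and suppose that $\tau(\mathcal F)\ge 1$ and $\tau(\mathcal G)\ge t$. Then $$|\mathcal F|+|\mathcal G|\;\le\;\binom{n}{a}+\sum_{i=1}^{t}(-1)^i\binom{t}{i}\binom{n-ib}{a}+t. \qquad (*)$$ For pairwise disjoint $B_1,\dots,B_t\in\binom{[n]}{b}$ let $$\mathcal M^t(n,a,b)=\{B_1,\dots,B_t\}\;\cup\;\Bigl\{A\in\tbinom{[n]}{a}: A\cap B_i\neq\emptyset\text{ for all }1\le i\le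 t\Bigr\},$$ which up to a permutation of $[n]$ does not depend on the choice of the $B_i$. Here and in $\mathcal F\cup\mathcal G$ the union is taken with multiplicity, i.e. a set that belongs to both of the two families is counted twice (this matters only if $a=b$, which forces $t=1$). Two such collections are isomorphic if a permutation of $[n]$ carries one to the other. Suppose moreover that $n>a+b$. If $\mathcal F\cup\mathcal G$ is isomorphic to $\mathcal M^t(n,a,b)$, then equality holds in $(*)$. Conversely, if equality holds in $(*)$ and $(a,b)\neq(2,2)$, then $\mathcal F\cup\mathcal G$ is isomorphic to $\mathcal M^t(n,a,b)$. -/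

import Mathlib

/-- `𝓕` and `𝓖` are cross-intersecting: every member of `𝓕` meets every member of `𝓖`. -/
def CrossIntersecting {n : ℕ} (𝓕 𝓖 : Finset (Finset (Fin n))) : Prop :=
  ∀ F ∈ 𝓕, ∀ G ∈ 𝓖, (F ∩ G).Nonempty

/-- `T` is a cover (transversal) of `𝓕`: it meets every member of `𝓕`. -/
def IsCover {n : ℕ} (𝓕 : Finset (Finset (Fin n))) (T : Finset (Fin n)) : Prop :=
  ∀ F ∈ 𝓕, (T ∩ F).Nonempty

/-- The covering number: the minimum size of a cover. A family that does not contain the empty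
set has a cover (the whole ground set), so for such a family the minimum is attained. -/
noncomputable def coveringNumber {n : ℕ} (𝓕 : Finset (Finset (Fin n))) : ℕ :=
  sInf {k : ℕ | ∃ T : Finset (Fin n), IsCover 𝓕 T ∧ T.card = k}

/-- Two collections of subsets of the ground set (members counted with multiplicity) are
isomorphic if a permutation of the ground set carries one to the other. -/
def FamilyIso {n : ℕ} (𝓐 𝓑 : Multiset (Finset (Fin n))) : Prop :=
  ∃ σ : Equiv.Perm (Fin n), 𝓐.map (fun S => S.map σ.toEmbedding) = 𝓑

/-- The union of the family `{B₁, …, B_t}` and the family of all `a`-subsets of the ground set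
that meet every `B i`. It is a union with multiplicity: a set that lies in both families (this
is possible only if it is some `B i` of size `a`) is counted twice. -/
def extremalFamily {n t : ℕ} (a : ℕ) (B : Fin t → Finset (Fin n)) :
    Multiset (Finset (Fin n)) :=
  (Finset.univ.image B).val +
    ((Finset.powersetCard a Finset.univ).filter (fun A => ∀ i, (A ∩ B i).Nonempty)).val

/-- `𝓐` is isomorphic to the extremal family built from `t` pairwise disjoint `b`-sets. -/
def IsoToExtremal {n : ℕ} (t a b : ℕ) (𝓐 : Multiset (Finset (Fin n))) : Prop :=
  ∃ B : Fin t → Finset (Fin n),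
    (∀ i, (B i).card = b) ∧ (∀ i j, i ≠ j → Disjoint (B i) (B j)) ∧
      FamilyIso 𝓐 (extremalFamily a B)

/-! Since `𝓕` lies in the family of all `a`-covers of `𝓖`, it suffices to bound the number of these
covers plus `#𝓖`. Fix `x` in some `G ∈ 𝓖` and in some cover. Covers through `x` are, after deleting
`x`, the `(a - 1)`-covers of the members avoiding `x`, whose covering number drops by at most one;
together with those members they are handled by induction on `t`. What remains is the covers
avoiding `x` and the members through `x`. Such a cover must meet the traces `H \ {x}`, which have
size `b - 1`, so `card_hitting_union_add_card_le` charges the members against lost covers, up to a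
single `+ 1`. The `t` steps produce the summand `t`, and `hitCount` satisfies exactly the recursion
of this splitting. The condition `b * t ≤ n` serves only to turn `hitCount` into the alternating
sum.

The charging lemma is the same splitting, with the traces shrinking down to the empty set; its base
is normalized matching for disjointness (`card_hitting_add_card_le_choose`). That base fails for the
induction step at covering number one with `a = b`, where the link would compare `b`-sets with `(b -
1)`-covers. There Kruskal–Katona replaces the smaller family by a star, which has no members
avoiding the centre.

Equality passes to every such link and forces each element of a cover to lie in at most one member.
Hence `#𝓖 ≤ a`, which bars every alternative to `#𝓖 = t`; with covering number `t` the members are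
then pairwise disjoint. -/

/-! ### The recursive count of transversals -/

/-- The number of `a`-subsets of an `n`-set that meet each of `t` pairwise disjoint sets, one of
size `c` and the other `t - 1` of size `b` (for `t = 0`, the number of all `a`-subsets). -/
def hitCount (b : ℕ) : ℕ → ℕ → ℕ → ℕ → ℕ
  | 0, _, n, a => n.choose a
  | _ + 1, 0, _, _ => 0
  | _ + 1, _ + 1, 0, _ => 0
  | _ + 1, _ + 1, _ + 1, 0 => 0
  | t + 1, c + 1, n + 1, a + 1 => hitCount b t b n a + hitCount b (t + 1) c n (a + 1)
  termination_by t c => (t, c)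

theorem hitCount_zero (b c n a : ℕ) : hitCount b 0 c n a = n.choose a := by
  simp [hitCount]

theorem hitCount_succ_zero (b t n a : ℕ) : hitCount b (t + 1) 0 n a = 0 := by
  simp [hitCount]

theorem hitCount_succ_succ (b t c n a : ℕ) :
    hitCount b (t + 1) (c + 1) (n + 1) (a + 1) =
      hitCount b t b n a + hitCount b (t + 1) c n (a + 1) := by
  rw [hitCount]

theorem hitCount_ground_zero (b t c a : ℕ) : hitCount b (t + 1) c 0 a = 0 := by
  cases c <;> simp [hitCount]

theorem hitCount_size_zero (b t c n : ℕ) : hitCount b (t + 1) c n 0 = 0 := by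
  cases c <;> cases n <;> simp [hitCount]

/-- Counts the new transversals that contain the added element and avoid the other `c` elements of
its set. -/
theorem hitCount_add_le_succ (b t c n a : ℕ) (hn : c + 1 ≤ n) :
    hitCount b (t + 1) c n (a + 1) + hitCount b t b (n - c - 1) a ≤
      hitCount b (t + 1) (c + 1) n (a + 1) := by
  induction c generalizing n with
  | zero =>
    obtain ⟨n, rfl⟩ : ∃ m, n = m + 1 := ⟨n - 1, by omega⟩
    simp [hitCount_succ_succ, hitCount_succ_zero]
  | succ c ih =>
    obtain ⟨n, rfl⟩ : ∃ m, n = m + 1 := ⟨n - 1, by omega⟩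
    have := ih n (by omega)
    rw [hitCount_succ_succ, hitCount_succ_succ, show n + 1 - (c + 1) - 1 = n - c - 1 by omega]
    omega

theorem hitCount_mono (b t : ℕ) {c c' : ℕ} (h : c ≤ c') (n a : ℕ) :
    hitCount b (t + 1) c n a ≤ hitCount b (t + 1) c' n a := by
  induction c' generalizing c n with
  | zero => obtain rfl : c = 0 := by omega
            exact le_rfl
  | succ c' ih =>
    rcases c with _ | c
    · simp [hitCount_succ_zero]
    rcases n with _ | n
    · simp [hitCount_ground_zero]
    rcases a with _ | a
    · simp [hitCount_size_zero]
    rw [hitCount_succ_succ, hitCount_succ_succ]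
    have := ih (c := c) (by omega) n
    omega

/-- One representative can be fixed in each of the `t` sets, and the other `a - t` elements are
free. -/
theorem choose_le_hitCount {b t n a : ℕ} (hb : 1 ≤ b) (hta : t ≤ a) (han : a ≤ n) :
    (n - t).choose (a - t) ≤ hitCount b t b n a := by
  induction t generalizing n a with
  | zero => simp [hitCount_zero]
  | succ t ih =>
    obtain ⟨n, rfl⟩ : ∃ m, n = m + 1 := ⟨n - 1, by omega⟩
    obtain ⟨a, rfl⟩ : ∃ m, a = m + 1 := ⟨a - 1, by omega⟩
    obtain ⟨c, hc⟩ : ∃ m, b = m + 1 := ⟨b - 1, by omega⟩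
    have := ih (n := n) (a := a) (by omega) (by omega)
    have h2 : hitCount b (t + 1) b (n + 1) (a + 1) =
      hitCount b t b n a + hitCount b (t + 1) c n (a + 1) := by
      conv_lhs => rw [hc]
      rw [← hc]; conv_lhs => arg 3; rw [hc]
      rw [hitCount_succ_succ]
    rw [h2, Nat.add_sub_add_right, Nat.add_sub_add_right]
    omega

theorem le_choose_of_pos_of_lt {n k : ℕ} (hk : 1 ≤ k) (hkn : k < n) : n ≤ n.choose k := by
  induction n generalizing k with
  | zero => omega
  | succ n ih =>
    obtain ⟨k, rfl⟩ : ∃ m, k = m + 1 := ⟨k - 1, by omega⟩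
    rw [Nat.choose_succ_succ']
    rcases Nat.eq_or_lt_of_le (show k + 1 ≤ n by omega) with h | h
    · subst h
      simp
    · have := ih (k := k + 1) (by omega) h
      have := Nat.choose_pos (show k ≤ n by omega)
      omega

/-- Enlarging the `c`-set to a `b`-set gives at least one more transversal. -/
theorem hitCount_succ_le {b t c n a : ℕ} (hc : c < b) (hca : t + 1 ≤ a) (hn : a + c ≤ n) :
    hitCount b (t + 1) c n a + 1 ≤ hitCount b (t + 1) b n a := by
  obtain ⟨a, rfl⟩ : ∃ m, a = m + 1 := ⟨a - 1, by omega⟩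
  have h1 := hitCount_add_le_succ b t c n a (by omega)
  have h2 := hitCount_mono b t (show c + 1 ≤ b by omega) n (a + 1)
  have h3 := choose_le_hitCount (b := b) (t := t) (n := n - c - 1) (a := a) (by omega) (by omega)
    (by omega)
  have := Nat.choose_pos (show a - t ≤ n - c - 1 - t by omega)
  omega

/-- The second unit of gain is the slack that makes the bounds strict in the study of equality. -/
theorem hitCount_add_two_le {b t c n a : ℕ} (hc : c < b) (hca : t + 2 ≤ a) (hn : a + c < n) :
    hitCount b (t + 1) c n a + 2 ≤ hitCount b (t + 1) b n a := by
  obtain ⟨a, rfl⟩ : ∃ m, a = m + 1 := ⟨a - 1, by omega⟩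
  have h1 := hitCount_add_le_succ b t c n a (by omega)
  have h2 := hitCount_mono b t (show c + 1 ≤ b by omega) n (a + 1)
  have h3 := choose_le_hitCount (b := b) (t := t) (n := n - c - 1) (a := a) (by omega) (by omega)
    (by omega)
  have := le_choose_of_pos_of_lt (show 1 ≤ a - t by omega) (show a - t < n - c - 1 - t by omega)
  omega

/-! ### Inclusion–exclusion for the transversal count -/

/-- Pascal's rule for `hitCount`: an element outside the sets to be met is in or out. -/
theorem hitCount_pascal (b t c n a : ℕ) (hc : t = 0 ∨ b * (t - 1) + c ≤ n) :
    hitCount b t c (n + 1) (a + 1) = hitCount b t c n (a + 1) + hitCount b t c n a := by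
  induction t generalizing c n a with
  | zero => simp only [hitCount_zero]; rw [Nat.choose_succ_succ', add_comm]
  | succ t iht =>
    replace hc : b * t + c ≤ n := by simpa using hc
    induction c generalizing n a with
    | zero => simp [hitCount_succ_zero]
    | succ c ih =>
      obtain ⟨n, rfl⟩ : ∃ m, n = m + 1 := ⟨n - 1, by omega⟩
      have ht : t = 0 ∨ b * (t - 1) + b ≤ n := by
        rcases t with _ | t
        · simp
        · right; rw [Nat.mul_succ] at hc; simp; omega
      rcases a with _ | a
      · rw [hitCount_succ_succ, hitCount_size_zero, hitCount_succ_succ, ih n 0 (by omega),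
          hitCount_size_zero]
        rcases t with _ | t
        · simp [hitCount_zero]
        · simp [hitCount_size_zero]
      · rw [hitCount_succ_succ, hitCount_succ_succ, hitCount_succ_succ, ih n (a + 1) (by omega),
          iht b n a ht]
        omega

/-- Transversals of `t` sets either meet or avoid a further disjoint `c`-set; the hypothesis makes
room for that set. -/
theorem hitCount_succ_add (b t c n a : ℕ) (hc : b * t + c ≤ n) :
    hitCount b (t + 1) c n a + hitCount b t b (n - c) a = hitCount b t b n a := by
  induction c generalizing n with
  | zero => simp [hitCount_succ_zero]
  | succ c ih =>
    obtain ⟨n, rfl⟩ : ∃ m, n = m + 1 := ⟨n - 1, by omega⟩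
    have ht : t = 0 ∨ b * (t - 1) + b ≤ n := by
      rcases t with _ | t
      · simp
      · right; rw [Nat.mul_succ] at hc; simp; omega
    rcases a with _ | a
    · rw [hitCount_size_zero]
      rcases t with _ | t
      · simp [hitCount_zero]
      · simp [hitCount_size_zero]
    · have := ih n (by omega)
      rw [hitCount_succ_succ, hitCount_pascal b t b n a ht, Nat.add_sub_add_right]
      omega

theorem sum_alternating_choose_succ (b t n a : ℕ) :
    ∑ i ∈ Finset.range (t + 2), (-1 : ℤ) ^ i * ((t + 1).choose i : ℤ) * ((n - i * b).choose a : ℤ) =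
      ∑ i ∈ Finset.range (t + 1), (-1 : ℤ) ^ i * (t.choose i : ℤ) * ((n - i * b).choose a : ℤ) -
      ∑ i ∈ Finset.range (t + 1),
        (-1 : ℤ) ^ i * (t.choose i : ℤ) * ((n - b - i * b).choose a : ℤ) := by
  rw [Finset.sum_range_succ']
  have h1 : ∀ i, n - (i + 1) * b = n - b - i * b := fun i => by
    rw [Nat.succ_mul]; omega
  simp only [h1, Nat.choose_succ_succ, Nat.cast_add, pow_succ]
  have h2 : ∑ i ∈ Finset.range (t + 1),
      (-1 : ℤ) ^ i * (t.choose i : ℤ) * ((n - i * b).choose a : ℤ) =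
      ∑ i ∈ Finset.range (t + 1),
        (-1 : ℤ) ^ i * -1 * (t.choose (i + 1) : ℤ) * ((n - b - i * b).choose a : ℤ) +
        (n.choose a : ℤ) := by
    -- Append the vanishing term `i = t + 1`, then split off `i = 0`.
    have h3 := Finset.sum_range_succ
      (fun i => (-1 : ℤ) ^ i * (t.choose i : ℤ) * ((n - i * b).choose a : ℤ)) (t + 1)
    have h4 := Finset.sum_range_succ'
      (fun i => (-1 : ℤ) ^ i * (t.choose i : ℤ) * ((n - i * b).choose a : ℤ)) (t + 1)
    simp only [Nat.choose_succ_self, h1, pow_succ] at h3 h4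
    simp at h3 h4
    rw [← h3, h4]
    simp
  rw [h2, ← sub_eq_zero]
  simp [mul_add, add_mul, Finset.sum_add_distrib]
  ring

theorem hitCount_eq_sum (b t n a : ℕ) (hn : b * t ≤ n) :
    (hitCount b t b n a : ℤ) =
      ∑ i ∈ Finset.range (t + 1), (-1 : ℤ) ^ i * (t.choose i : ℤ) * ((n - i * b).choose a : ℤ) := by
  induction t generalizing n with
  | zero => simp [hitCount_zero]
  | succ t ih =>
    rw [Nat.mul_succ] at hn
    rw [sum_alternating_choose_succ, ← ih n (by omega), ← ih (n - b) (by omega),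
      ← hitCount_succ_add b t b n a hn]
    push_cast; ring

/-! ### Covers of a family and the splitting at an element -/

section Hitting

open Finset

variable {α : Type*} [DecidableEq α]

/-- The `a`-subsets of `U` that meet every member of `𝓖`. -/
def hitting (a : ℕ) (U : Finset α) (𝓖 : Finset (Finset α)) : Finset (Finset α) :=
  {A ∈ powersetCard a U | ∀ G ∈ 𝓖, (A ∩ G).Nonempty}

/-- Every cover of `𝓖` inside `U` has at least `t` elements. -/
def CoversLarge (t : ℕ) (U : Finset α) (𝓖 : Finset (Finset α)) : Prop :=
  ∀ S ⊆ U, (∀ G ∈ 𝓖, (S ∩ G).Nonempty) → t ≤ #S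

theorem mem_hitting {a : ℕ} {U A : Finset α} {𝓖 : Finset (Finset α)} :
    A ∈ hitting a U 𝓖 ↔ (A ⊆ U ∧ #A = a) ∧ ∀ G ∈ 𝓖, (A ∩ G).Nonempty := by
  simp [hitting, mem_powersetCard]

theorem hitting_subset (a : ℕ) (U : Finset α) (𝓖 : Finset (Finset α)) :
    hitting a U 𝓖 ⊆ powersetCard a U :=
  filter_subset _ _

theorem inter_nonempty_iff {A G : Finset α} : (A ∩ G).Nonempty ↔ ∃ x ∈ A, x ∈ G := by
  simp [Finset.Nonempty, mem_inter]

theorem memberSubfamily_subset_powersetCard {c : ℕ} {U : Finset α} {𝓗 : Finset (Finset α)}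
    (h : 𝓗 ⊆ powersetCard (c + 1) U) (x : α) :
    𝓗.memberSubfamily x ⊆ powersetCard c (U.erase x) := by
  intro S hS
  rw [mem_memberSubfamily] at hS
  have := mem_powersetCard.1 (h hS.1)
  rw [card_insert_of_notMem hS.2, insert_subset_iff] at this
  exact mem_powersetCard.2 ⟨subset_erase.2 ⟨this.1.2, hS.2⟩, by omega⟩

theorem nonMemberSubfamily_subset_powersetCard {c : ℕ} {U : Finset α} {𝓗 : Finset (Finset α)}
    (h : 𝓗 ⊆ powersetCard c U) (x : α) :
    𝓗.nonMemberSubfamily x ⊆ powersetCard c (U.erase x) := by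
  intro S hS
  rw [mem_nonMemberSubfamily] at hS
  have := mem_powersetCard.1 (h hS.1)
  exact mem_powersetCard.2 ⟨subset_erase.2 ⟨this.1, hS.2⟩, this.2⟩

theorem memberSubfamily_nonempty {𝓗 : Finset (Finset α)} {H : Finset α} {x : α} (hH : H ∈ 𝓗)
    (hx : x ∈ H) : (𝓗.memberSubfamily x).Nonempty :=
  ⟨H.erase x, by simp [mem_memberSubfamily, insert_erase hx, hH]⟩

/-- A cover through `x` already meets every member through `x`, so only the members avoiding `x`
constrain the rest of it. -/
theorem memberSubfamily_hitting_succ (a : ℕ) {U : Finset α} (𝓖 : Finset (Finset α)) {x : α}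
    (hx : x ∈ U) :
    (hitting (a + 1) U 𝓖).memberSubfamily x =
      hitting a (U.erase x) (𝓖.nonMemberSubfamily x) := by
  ext A
  simp only [mem_memberSubfamily, mem_hitting, mem_nonMemberSubfamily, inter_nonempty_iff,
    insert_subset_iff, subset_erase]
  constructor
  · rintro ⟨⟨⟨⟨_, h1⟩, h2⟩, h3⟩, h4⟩
    rw [card_insert_of_notMem h4] at h2
    refine ⟨⟨⟨h1, h4⟩, by omega⟩, fun G hG => ?_⟩
    obtain ⟨y, hy, hyG⟩ := h3 G hG.1
    rcases mem_insert.1 hy with rfl | hy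
    · exact absurd hyG hG.2
    · exact ⟨y, hy, hyG⟩
  · rintro ⟨⟨⟨h1, h4⟩, h2⟩, h3⟩
    refine ⟨⟨⟨⟨hx, h1⟩, by rw [card_insert_of_notMem h4]; omega⟩, fun G hG => ?_⟩, h4⟩
    by_cases hxG : x ∈ G
    · exact ⟨x, mem_insert_self _ _, hxG⟩
    · obtain ⟨y, hy, hyG⟩ := h3 G ⟨hG, hxG⟩
      exact ⟨y, mem_insert_of_mem hy, hyG⟩

theorem card_hitting_succ (a : ℕ) {U : Finset α} (𝓖 : Finset (Finset α)) {x : α} (hx : x ∈ U) :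
    #(hitting (a + 1) U 𝓖) =
      #(hitting a (U.erase x) (𝓖.nonMemberSubfamily x)) + #(hitting (a + 1) (U.erase x) 𝓖) := by
  rw [← card_memberSubfamily_add_card_nonMemberSubfamily x (hitting (a + 1) U 𝓖),
    memberSubfamily_hitting_succ a 𝓖 hx]
  congr 2
  ext A
  simp only [mem_nonMemberSubfamily, mem_hitting, subset_erase]
  tauto

theorem CoversLarge.erase {t : ℕ} {U : Finset α} {𝓖 : Finset (Finset α)} (h : CoversLarge t U 𝓖)
    (x : α) : CoversLarge t (U.erase x) 𝓖 :=
  fun S hS => h S (hS.trans (erase_subset _ _))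

theorem CoversLarge.nonMemberSubfamily {t : ℕ} {U : Finset α} {𝓖 : Finset (Finset α)}
    (h : CoversLarge (t + 1) U 𝓖) {x : α} (hx : x ∈ U) :
    CoversLarge t (U.erase x) (𝓖.nonMemberSubfamily x) := by
  intro S hS hc
  have := h (insert x S) (insert_subset hx (hS.trans (erase_subset _ _))) fun G hG => by
    by_cases hxG : x ∈ G
    · exact inter_nonempty_iff.2 ⟨x, mem_insert_self _ _, hxG⟩
    · exact (hc G (mem_nonMemberSubfamily.2 ⟨hG, hxG⟩)).mono
        (inter_subset_inter_right (subset_insert _ _))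
  have h2 := card_insert_le x S
  omega

theorem CoversLarge.nonempty {t : ℕ} {U : Finset α} {𝓖 : Finset (Finset α)}
    (h : CoversLarge (t + 1) U 𝓖) : 𝓖.Nonempty := by
  by_contra hG
  rw [not_nonempty_iff_eq_empty] at hG
  have := h ∅ (empty_subset _) (by simp [hG])
  simp at this

theorem card_inter_erase_le {b : ℕ} {U : Finset α} {𝓖 : Finset (Finset α)}
    (h : ∀ G ∈ 𝓖, #(G ∩ U) ≤ b) (x : α) : ∀ G ∈ 𝓖, #(G ∩ U.erase x) ≤ b :=
  fun G hG => (card_le_card (inter_subset_inter_left (erase_subset _ _))).trans (h G hG)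

theorem card_inter_erase_le_nonMember {b : ℕ} {U : Finset α} {𝓖 : Finset (Finset α)}
    (h : ∀ G ∈ 𝓖, #(G ∩ U) ≤ b) (x : α) :
    ∀ G ∈ 𝓖.nonMemberSubfamily x, #(G ∩ U.erase x) ≤ b :=
  fun G hG => card_inter_erase_le h x G (mem_nonMemberSubfamily.1 hG).1

theorem hitting_zero {U : Finset α} {𝓖 : Finset (Finset α)} (h : 𝓖.Nonempty) :
    hitting 0 U 𝓖 = ∅ := by
  obtain ⟨G, hG⟩ := h
  ext A
  simp only [mem_hitting, card_eq_zero, notMem_empty, iff_false]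
  rintro ⟨⟨_, rfl⟩, h⟩
  simpa using h G hG

theorem hitting_eq_empty {a : ℕ} {U G : Finset α} {𝓖 : Finset (Finset α)} (hG : G ∈ 𝓖)
    (h : G ∩ U = ∅) : hitting a U 𝓖 = ∅ := by
  ext A
  simp only [mem_hitting, notMem_empty, iff_false]
  rintro ⟨⟨hA, _⟩, h'⟩
  obtain ⟨y, hy, hyG⟩ := inter_nonempty_iff.1 (h' G hG)
  exact notMem_empty y (h ▸ mem_inter.2 ⟨hyG, hA hy⟩)

/-- A family of sets of size at most `b` with large covers has at most as many `a`-covers as `t`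
disjoint `b`-sets; a member of size at most `c` improves the bound. -/
theorem card_hitting_le_of_mem {b t : ℕ}
    (ih : ∀ (a : ℕ) (U : Finset α) (𝓖 : Finset (Finset α)), (∀ G ∈ 𝓖, #(G ∩ U) ≤ b) →
      CoversLarge t U 𝓖 → #(hitting a U 𝓖) ≤ hitCount b t b #U a)
    {a c : ℕ} {U C : Finset α} {𝓖 : Finset (Finset α)} (hb : ∀ G ∈ 𝓖, #(G ∩ U) ≤ b)
    (hτ : CoversLarge (t + 1) U 𝓖) (hC : C ∈ 𝓖) (hc : #(C ∩ U) ≤ c) :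
    #(hitting a U 𝓖) ≤ hitCount b (t + 1) c #U a := by
  rcases a with _ | a
  · simp [hitting_zero ⟨C, hC⟩]
  induction c generalizing U with
  | zero => simp [hitting_eq_empty hC (card_eq_zero.1 (Nat.le_zero.1 hc))]
  | succ c ihc =>
    rcases (C ∩ U).eq_empty_or_nonempty with h | ⟨x, hx⟩
    · simp [hitting_eq_empty hC h]
    have hxU := (mem_inter.1 hx).2
    obtain ⟨m, hm⟩ : ∃ m, #U = m + 1 := ⟨#U - 1, by have := card_pos.2 ⟨x, hxU⟩; omega⟩
    have hm' : #(U.erase x) = m := by rw [card_erase_of_mem hxU, hm]; rfl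
    have h1 := ih a (U.erase x) _ (card_inter_erase_le_nonMember hb x)
      (hτ.nonMemberSubfamily hxU)
    -- Covers avoiding `x` still face all of `𝓖`; only traces on the ground set shrink, which is why
    -- sizes are measured by `G ∩ U`.
    have h2 := ihc (card_inter_erase_le hb x) (hτ.erase x) (by
      have h3 : C ∩ U.erase x = (C ∩ U).erase x := by rw [inter_erase]
      rw [h3, card_erase_of_mem hx]; omega)
    rw [card_hitting_succ a 𝓖 hxU, hm, hitCount_succ_succ]
    rw [hm'] at h1 h2
    omega

theorem card_hitting_le {b : ℕ} (t : ℕ) : ∀ (a : ℕ) (U : Finset α) (𝓖 : Finset (Finset α)),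
    (∀ G ∈ 𝓖, #(G ∩ U) ≤ b) → CoversLarge t U 𝓖 → #(hitting a U 𝓖) ≤ hitCount b t b #U a := by
  induction t with
  | zero =>
    intro a U 𝓖 _ _
    rw [hitCount_zero, ← card_powersetCard]
    exact card_filter_le _ _
  | succ t ih =>
    intro a U 𝓖 hb hτ
    obtain ⟨G, hG⟩ := hτ.nonempty
    exact card_hitting_le_of_mem ih hb hτ hG (hb G hG)

/-! ### Charging members of a family to lost covers -/

/-- Normalized matching between two levels for the disjointness relation. -/
theorem card_mul_choose_le {a c : ℕ} {U : Finset α} {𝓗 : Finset (Finset α)}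
    (h : 𝓗 ⊆ powersetCard c U) :
    #𝓗 * (#U - c).choose a + #(hitting a U 𝓗) * (#U - a).choose c ≤
      (#U).choose a * (#U - a).choose c := by
  set 𝓝 : Finset (Finset α) := {A ∈ powersetCard a U | ¬ ∀ G ∈ 𝓗, (A ∩ G).Nonempty} with h𝓝
  have h1 : #(hitting a U 𝓗) + #𝓝 = (#U).choose a := by
    rw [← card_powersetCard]
    exact card_filter_add_card_filter_not _
  rw [← h1, add_mul, add_comm]
  refine Nat.add_le_add_left ?_ _
  -- Double count disjoint pairs: an `a`-set disjoint from a member is not a cover.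
  refine card_mul_le_card_mul (fun H A : Finset α => Disjoint A H) (fun H hH => ?_)
    (fun _ hA => ?_)
  · have hH' := mem_powersetCard.1 (h hH)
    rw [← hH'.2, ← card_sdiff_of_subset hH'.1, ← card_powersetCard]
    refine card_le_card fun A hA => ?_
    rw [mem_powersetCard, subset_sdiff] at hA
    rw [mem_bipartiteAbove, h𝓝, mem_filter, mem_powersetCard]
    refine ⟨⟨⟨hA.1.1, hA.2⟩, fun h' => ?_⟩, hA.1.2⟩
    exact not_nonempty_iff_eq_empty.2 (disjoint_iff_inter_eq_empty.1 hA.1.2) (h' H hH)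
  · have hA' := mem_powersetCard.1 (mem_filter.1 hA).1
    rw [← hA'.2, ← card_sdiff_of_subset hA'.1, ← card_powersetCard]
    refine card_le_card fun H hH => ?_
    rw [mem_bipartiteBelow] at hH
    have hH' := mem_powersetCard.1 (h hH.1)
    rw [mem_powersetCard, subset_sdiff]
    exact ⟨⟨hH'.1, hH.2.symm⟩, hH'.2⟩

theorem choose_sub_le_choose_sub {a c n : ℕ} (hca : c ≤ a) (hn : a + c ≤ n) :
    (n - a).choose c ≤ (n - c).choose a := by
  obtain ⟨d, rfl⟩ := Nat.exists_eq_add_of_le hn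
  rw [show a + c + d - a = c + d by omega, show a + c + d - c = a + d by omega,
    Nat.choose_symm_add, Nat.choose_symm_add]
  exact Nat.choose_le_choose d (by omega)

theorem choose_sub_lt_choose_sub {a c n : ℕ} (hca : c < a) (hn : a + c < n) :
    (n - a).choose c < (n - c).choose a := by
  obtain ⟨d, rfl⟩ := Nat.exists_eq_add_of_lt hn
  rw [show a + c + d + 1 - a = c + (d + 1) by omega,
    show a + c + d + 1 - c = a + (d + 1) by omega, Nat.choose_symm_add, Nat.choose_symm_add]
  calc (c + (d + 1)).choose (d + 1) < (c + (d + 1) + 1).choose (d + 1) := by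
        rw [Nat.choose_succ_succ' (c + (d + 1)) d]
        have := Nat.choose_pos (show d ≤ c + (d + 1) by omega)
        omega
    _ ≤ _ := Nat.choose_le_choose _ (by omega)

theorem card_hitting_add_card_le_choose {a c : ℕ} {U : Finset α} {𝓗 : Finset (Finset α)}
    (h : 𝓗 ⊆ powersetCard c U) (hca : c ≤ a) (hn : a + c ≤ #U) :
    #(hitting a U 𝓗) + #𝓗 ≤ (#U).choose a := by
  have h1 := card_mul_choose_le (a := a) h
  have h2 := choose_sub_le_choose_sub hca hn
  have h3 := Nat.choose_pos (show c ≤ #U - a by omega)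
  refine Nat.le_of_mul_le_mul_right ?_ h3
  nlinarith [Nat.mul_le_mul_left (#𝓗) h2]

theorem card_hitting_add_card_lt_choose {a c : ℕ} {U : Finset α} {𝓗 : Finset (Finset α)}
    (h : 𝓗 ⊆ powersetCard c U) (hne : 𝓗.Nonempty) (hca : c < a) (hn : a + c < #U) :
    #(hitting a U 𝓗) + #𝓗 < (#U).choose a := by
  have h1 := card_mul_choose_le (a := a) h
  have h2 := choose_sub_lt_choose_sub hca hn
  refine Nat.lt_of_mul_lt_mul_right (a := (#U - a).choose c) ?_
  nlinarith [Nat.mul_lt_mul_of_pos_left h2 (card_pos.2 hne)]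

theorem hitting_subset_of_subset {a : ℕ} {U : Finset α} {𝓖 𝓖' : Finset (Finset α)}
    (h : 𝓖' ⊆ 𝓖) : hitting a U 𝓖 ⊆ hitting a U 𝓖' := fun _ hA =>
  mem_hitting.2 ⟨(mem_hitting.1 hA).1, fun G hG => (mem_hitting.1 hA).2 G (h hG)⟩

/-- On `U \ {x}`, members of `𝓗` through `x` may be replaced by their traces. -/
theorem hitting_erase_union_subset {a : ℕ} {U : Finset α} (𝓖 𝓗 : Finset (Finset α)) (x : α) :
    hitting a (U.erase x) (𝓖 ∪ 𝓗) ⊆ hitting a (U.erase x) (𝓖 ∪ 𝓗.memberSubfamily x) := by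
  intro A hA
  rw [mem_hitting] at hA ⊢
  refine ⟨hA.1, fun G hG => ?_⟩
  rcases mem_union.1 hG with hG | hG
  · exact hA.2 G (mem_union_left _ hG)
  · obtain ⟨hG, hx⟩ := mem_memberSubfamily.1 hG
    obtain ⟨y, hy, hyG⟩ := inter_nonempty_iff.1 (hA.2 _ (mem_union_right _ hG))
    refine inter_nonempty_iff.2 ⟨y, hy, ?_⟩
    rcases mem_insert.1 hyG with rfl | h
    · exact absurd rfl (mem_erase.1 (hA.1.1 hy)).1
    · exact h

theorem nonMemberSubfamily_union_eq (𝓖 𝓗 : Finset (Finset α)) (x : α) :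
    (𝓖 ∪ 𝓗).nonMemberSubfamily x = 𝓖.nonMemberSubfamily x ∪ 𝓗.nonMemberSubfamily x := by
  ext; simp only [mem_nonMemberSubfamily, mem_union]; tauto

/-- The inequality behind the induction: adding a family `𝓗` of `c`-sets, `c < b`, costs at least
`#𝓗 - 1` covers, compared with the best family having one member of size `c`. -/
theorem card_hitting_union_add_card_le_of {b t : ℕ}
    (hS : ∀ (c a : ℕ) (U : Finset α) (𝓖 𝓗 : Finset (Finset α)), (∀ G ∈ 𝓖, #(G ∩ U) ≤ b) →
      CoversLarge t U 𝓖 → 𝓗 ⊆ powersetCard c U → c < b → c + t ≤ a → a + c ≤ #U →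
      #(hitting a U (𝓖 ∪ 𝓗)) + #𝓗 ≤ hitCount b t b #U a)
    (c a : ℕ) (U : Finset α) (𝓖 𝓗 : Finset (Finset α)) (hb : ∀ G ∈ 𝓖, #(G ∩ U) ≤ b)
    (hτ : CoversLarge (t + 1) U 𝓖) (h𝓗 : 𝓗 ⊆ powersetCard c U) (hne : 𝓗.Nonempty) (hcb : c < b)
    (hca : c + t + 1 ≤ a) (hn : a + c ≤ #U) :
    #(hitting a U (𝓖 ∪ 𝓗)) + #𝓗 ≤ hitCount b (t + 1) c #U a + 1 := by
  induction c generalizing U 𝓗 with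
  | zero =>
    rw [powersetCard_zero] at h𝓗
    obtain rfl := (subset_singleton_iff.1 h𝓗).resolve_left hne.ne_empty
    -- Here `𝓗 = {∅}` has no covers and one member: this is the source of the `+ 1`.
    rw [hitting_eq_empty (mem_union_right _ (mem_singleton_self ∅)) (by simp)]
    simp
  | succ c ih =>
    obtain ⟨H, hH⟩ := hne
    have hH' := mem_powersetCard.1 (h𝓗 hH)
    obtain ⟨x, hx⟩ : H.Nonempty := card_pos.1 (by omega)
    have hxU := hH'.1 hx
    obtain ⟨a, rfl⟩ : ∃ m, a = m + 1 := ⟨a - 1, by omega⟩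
    obtain ⟨m, hm⟩ : ∃ m, #U = m + 1 := ⟨#U - 1, by omega⟩
    have hm' : #(U.erase x) = m := by rw [card_erase_of_mem hxU, hm]; rfl
    -- The branch through `x` has covering number one less and costs no extra unit, so the `+ 1` is
    -- paid only once, in the trace branch.
    have h1 := hS (c + 1) a (U.erase x) (𝓖.nonMemberSubfamily x) (𝓗.nonMemberSubfamily x)
      (card_inter_erase_le_nonMember hb x) (hτ.nonMemberSubfamily hxU)
      (nonMemberSubfamily_subset_powersetCard h𝓗 x) hcb (by omega) (by omega)
    have h2 := ih (U.erase x) (𝓗.memberSubfamily x) (card_inter_erase_le hb x) (hτ.erase x)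
      (memberSubfamily_subset_powersetCard h𝓗 x) (memberSubfamily_nonempty hH hx) (by omega)
      (by omega) (by omega)
    have h3 := card_le_card (hitting_erase_union_subset (a := a + 1) (U := U) 𝓖 𝓗 x)
    have h4 := card_memberSubfamily_add_card_nonMemberSubfamily x 𝓗
    rw [card_hitting_succ a _ hxU, nonMemberSubfamily_union_eq, hm, hitCount_succ_succ]
    rw [hm'] at h1 h2
    omega

/-- For nonempty `𝓗` and `t` positive, enlarging the `c`-set to a `b`-set gains at least one
transversal, which absorbs the `+ 1`. This closes the induction on `t`. -/
theorem card_hitting_union_add_card_le_hitCount {b : ℕ} (t : ℕ) :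
    ∀ (c a : ℕ) (U : Finset α) (𝓖 𝓗 : Finset (Finset α)), (∀ G ∈ 𝓖, #(G ∩ U) ≤ b) →
      CoversLarge t U 𝓖 → 𝓗 ⊆ powersetCard c U → c < b → c + t ≤ a → a + c ≤ #U →
      #(hitting a U (𝓖 ∪ 𝓗)) + #𝓗 ≤ hitCount b t b #U a := by
  induction t with
  | zero =>
    intro c a U 𝓖 𝓗 _ _ h𝓗 _ hca hn
    rw [hitCount_zero]
    exact (Nat.add_le_add_right (card_le_card (hitting_subset_of_subset subset_union_right)) _).trans
      (card_hitting_add_card_le_choose h𝓗 (by omega) hn)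
  | succ t ih =>
    intro c a U 𝓖 𝓗 hb hτ h𝓗 hcb hca hn
    rcases 𝓗.eq_empty_or_nonempty with rfl | hne
    · simpa using card_hitting_le (t + 1) a U 𝓖 hb hτ
    · exact (card_hitting_union_add_card_le_of ih c a U 𝓖 𝓗 hb hτ h𝓗 hne hcb hca hn).trans
        (hitCount_succ_le hcb (by omega) hn)

theorem card_hitting_union_add_card_le {b t c a : ℕ} {U : Finset α} {𝓖 𝓗 : Finset (Finset α)}
    (hb : ∀ G ∈ 𝓖, #(G ∩ U) ≤ b) (hτ : CoversLarge (t + 1) U 𝓖) (h𝓗 : 𝓗 ⊆ powersetCard c U)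
    (hne : 𝓗.Nonempty) (hcb : c < b) (hca : c + t + 1 ≤ a) (hn : a + c ≤ #U) :
    #(hitting a U (𝓖 ∪ 𝓗)) + #𝓗 ≤ hitCount b (t + 1) c #U a + 1 :=
  card_hitting_union_add_card_le_of (card_hitting_union_add_card_le_hitCount t) c a U 𝓖 𝓗 hb hτ h𝓗
    hne hcb hca hn

theorem card_hitting_union_add_card_lt_hitCount {b t c a : ℕ} {U : Finset α}
    {𝓖 𝓗 : Finset (Finset α)} (hb : ∀ G ∈ 𝓖, #(G ∩ U) ≤ b) (hτ : CoversLarge t U 𝓖)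
    (h𝓗 : 𝓗 ⊆ powersetCard c U) (hne : 𝓗.Nonempty) (hc : 1 ≤ c) (hcb : c < b) (hca : c + t ≤ a)
    (hn : a + c < #U) (h0 : t = 0 → c < a) :
    #(hitting a U (𝓖 ∪ 𝓗)) + #𝓗 < hitCount b t b #U a := by
  rcases t with _ | t
  · rw [hitCount_zero]
    exact (Nat.add_le_add_right (card_le_card (hitting_subset_of_subset subset_union_right))
      _).trans_lt (card_hitting_add_card_lt_choose h𝓗 hne (h0 rfl) hn)
  · have h1 := card_hitting_union_add_card_le hb hτ h𝓗 hne hcb hca hn.le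
    have h2 := hitCount_add_two_le (t := t) hcb (show t + 2 ≤ a by omega) hn
    omega

/-- Equality forces `𝓗` to have one member, away from the case `t = 1`, `a = c + 1`. -/
theorem card_eq_one_of_hitting_union_eq {b t c a : ℕ} {U : Finset α} {𝓖 𝓗 : Finset (Finset α)}
    (hb : ∀ G ∈ 𝓖, #(G ∩ U) ≤ b) (hτ : CoversLarge (t + 1) U 𝓖) (h𝓗 : 𝓗 ⊆ powersetCard c U)
    (hne : 𝓗.Nonempty) (hcb : c < b) (hca : c + t + 1 ≤ a) (hn : a + c < #U)
    (h0 : t = 0 → c + 1 < a)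
    (heq : #(hitting a U (𝓖 ∪ 𝓗)) + #𝓗 = hitCount b (t + 1) c #U a + 1) : #𝓗 = 1 := by
  induction c generalizing U 𝓗 with
  | zero =>
    rw [powersetCard_zero] at h𝓗
    obtain rfl := (subset_singleton_iff.1 h𝓗).resolve_left hne.ne_empty
    simp
  | succ c ih =>
    obtain ⟨H, hH⟩ := hne
    have hH' := mem_powersetCard.1 (h𝓗 hH)
    obtain ⟨x, hx⟩ : H.Nonempty := card_pos.1 (by omega)
    have hxU := hH'.1 hx
    obtain ⟨a, rfl⟩ : ∃ m, a = m + 1 := ⟨a - 1, by omega⟩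
    obtain ⟨m, hm⟩ : ∃ m, #U = m + 1 := ⟨#U - 1, by omega⟩
    have hm' : #(U.erase x) = m := by rw [card_erase_of_mem hxU, hm]; rfl
    have h1 := card_hitting_union_add_card_le_hitCount t (c + 1) a (U.erase x)
      (𝓖.nonMemberSubfamily x) (𝓗.nonMemberSubfamily x)
      (card_inter_erase_le_nonMember hb x) (hτ.nonMemberSubfamily hxU)
      (nonMemberSubfamily_subset_powersetCard h𝓗 x) hcb (by omega) (by omega)
    have h2 := card_hitting_union_add_card_le (card_inter_erase_le hb x) (hτ.erase x)
      (memberSubfamily_subset_powersetCard h𝓗 x) (memberSubfamily_nonempty hH hx) (by omega)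
      (show c + t + 1 ≤ a + 1 by omega) (by omega)
    have h3 := card_le_card (hitting_erase_union_subset (a := a + 1) (U := U) 𝓖 𝓗 x)
    have h4 := card_memberSubfamily_add_card_nonMemberSubfamily x 𝓗
    rw [card_hitting_succ a _ hxU, nonMemberSubfamily_union_eq, hm, hitCount_succ_succ] at heq
    rcases (𝓗.nonMemberSubfamily x).eq_empty_or_nonempty with he | he
    · have h5 := ih (card_inter_erase_le hb x) (hτ.erase x)
        (memberSubfamily_subset_powersetCard h𝓗 x) (memberSubfamily_nonempty hH hx) (by omega)
        (by omega) (by omega) (by omega) (by rw [hm'] at h1 h2 ⊢; omega)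
      rw [he, card_empty] at h4
      omega
    -- A member of `𝓗` avoiding `x` would make the branch through `x` strict.
    · have h5 := card_hitting_union_add_card_lt_hitCount
        (card_inter_erase_le_nonMember hb x) (hτ.nonMemberSubfamily hxU)
        (nonMemberSubfamily_subset_powersetCard h𝓗 x) he (by omega) hcb
        (show c + 1 + t ≤ a by omega) (by omega) (by omega)
      rw [hm'] at h1 h2 h5
      omega

end Hitting

/-! ### Kruskal–Katona and stars -/

section InitialSegments

open Finset Finset.Colex
open scoped FinsetFamily

theorem exists_isInitSeg_card_eq {m r k : ℕ} (hk : k ≤ m.choose r) :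
    ∃ 𝓔 : Finset (Finset (Fin m)), IsInitSeg 𝓔 r ∧ #𝓔 = k := by
  induction k with
  | zero => exact ⟨∅, isInitSeg_empty, card_empty⟩
  | succ k ih =>
    obtain ⟨𝓔, h𝓔, hcard⟩ := ih (by omega)
    have hne : (powersetCard r univ \ 𝓔).Nonempty := by
      rw [← card_pos]
      have := le_card_sdiff 𝓔 (powersetCard r (univ : Finset (Fin m)))
      rw [card_powersetCard, card_univ, Fintype.card_fin] at this
      omega
    obtain ⟨S, hS, hmin⟩ := exists_min_image _ (fun S : Finset (Fin m) => toColex S) hne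
    rw [mem_sdiff, mem_powersetCard] at hS
    refine ⟨insert S 𝓔, ⟨?_, ?_⟩, by rw [card_insert_of_notMem hS.2, hcard]⟩
    · intro T hT
      rcases mem_insert.1 (mem_coe.1 hT) with rfl | hT
      · exact hS.1.2
      · exact h𝓔.1 hT
    · rintro s t hs ⟨hlt, ht⟩
      rw [mem_insert] at hs ⊢
      rcases hs with rfl | hs
      · by_contra h
        push Not at h
        exact (hmin t (mem_sdiff.2 ⟨mem_powersetCard.2 ⟨subset_univ _, ht⟩, h.2⟩)).not_gt hlt
      · exact Or.inr (h𝓔.2 hs ⟨hlt, ht⟩)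

/-- Every `r`-set avoiding the last element precedes, in colex order, any `r`-set containing it. A
segment reaching the latter therefore has more than `m.choose r` members. -/
theorem last_notMem_of_isInitSeg {m r : ℕ} {𝓔 : Finset (Finset (Fin (m + 1)))}
    (h : IsInitSeg 𝓔 r) (hcard : #𝓔 ≤ m.choose r) {S : Finset (Fin (m + 1))} (hS : S ∈ 𝓔) :
    Fin.last m ∉ S := by
  intro hl
  have hsub : insert S (powersetCard r (univ.erase (Fin.last m))) ⊆ 𝓔 := by
    refine insert_subset hS fun T hT => ?_
    rw [mem_powersetCard, subset_erase] at hT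
    refine h.2 hS ⟨?_, hT.2⟩
    rw [toColex_lt_toColex_iff_exists_forall_lt]
    exact ⟨Fin.last m, hl, hT.1.2, fun b hb _ =>
      lt_of_le_of_ne (Fin.le_last b) fun he => hT.1.2 (he ▸ hb)⟩
  have := card_le_card hsub
  rw [card_insert_of_notMem (by simp [mem_powersetCard, subset_erase, hl]), card_powersetCard,
    card_erase_of_mem (mem_univ (Fin.last m)), card_univ, Fintype.card_fin] at this
  simp at this
  omega

/-- An `a`-set fails to be a cover exactly when it lies inside the complement of a member, that is,
in an iterated shadow of the complements. -/
theorem card_hitting_univ_add_card_shadow {m a b : ℕ} {𝓖 : Finset (Finset (Fin m))}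
    (h : 𝓖 ⊆ powersetCard b univ) (hm : a + b ≤ m) :
    #(hitting a univ 𝓖) + #(∂^[m - b - a] 𝓖ᶜˢ) = m.choose a := by
  have h1 : ∂^[m - b - a] 𝓖ᶜˢ =
      {A ∈ powersetCard a (univ : Finset (Fin m)) | ¬ ∀ G ∈ 𝓖, (A ∩ G).Nonempty} := by
    ext A
    rw [mem_shadow_iterate_iff_exists_mem_card_add, mem_filter, mem_powersetCard]
    push Not
    constructor
    · rintro ⟨S, hS, hAS, hc⟩
      rw [mem_compls] at hS
      have h2 := (mem_powersetCard.1 (h hS)).2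
      rw [card_compl, Fintype.card_fin] at h2
      have h3 := card_le_univ S
      rw [Fintype.card_fin] at h3
      exact ⟨⟨subset_univ _, by omega⟩, Sᶜ, hS,
        disjoint_iff_inter_eq_empty.1 (disjoint_compl_right_iff.2 hAS)⟩
    · rintro ⟨⟨-, hA⟩, G, hG, hAG⟩
      refine ⟨Gᶜ, by simpa using hG, ?_, ?_⟩
      · refine disjoint_compl_right_iff.1 ?_
        rw [compl_compl]
        exact disjoint_iff_inter_eq_empty.2 hAG
      · have h2 := (mem_powersetCard.1 (h hG)).2
        rw [card_compl, Fintype.card_fin]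
        omega
  rw [h1, hitting, card_filter_add_card_filter_not, card_powersetCard, card_univ, Fintype.card_fin]

theorem sized_compls_of_subset {m b : ℕ} {𝓖 : Finset (Finset (Fin m))}
    (h : 𝓖 ⊆ powersetCard b univ) : (𝓖ᶜˢ : Set (Finset (Fin m))).Sized (m - b) := by
  intro S hS
  have h2 := (mem_powersetCard.1 (h (mem_compls.1 (mem_coe.1 hS)))).2
  have h3 := card_le_univ S
  rw [card_compl, Fintype.card_fin] at h2
  rw [Fintype.card_fin] at h3
  omega

/-- A small family has at most as many `a`-covers as some family of the same size whose members
share an element. -/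
theorem exists_star_hitting_ge {m a b : ℕ} {𝓖 : Finset (Finset (Fin m))}
    (h : 𝓖 ⊆ powersetCard b univ) (hb : 1 ≤ b) (hm : a + b ≤ m)
    (hcard : #𝓖 ≤ (m - 1).choose (b - 1)) :
    ∃ 𝓔 ⊆ powersetCard b (univ : Finset (Fin m)), #𝓔 = #𝓖 ∧ (∃ x, ∀ C ∈ 𝓔, x ∈ C) ∧
      #(hitting a univ 𝓖) ≤ #(hitting a univ 𝓔) := by
  obtain ⟨m, rfl⟩ : ∃ k, m = k + 1 := ⟨m - 1, by omega⟩
  have hsymm : (m + 1 - 1).choose (b - 1) = m.choose (m + 1 - b) := by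
    rw [← Nat.choose_symm (by omega)]; congr 1; omega
  have h𝓖 : #𝓖 ≤ m.choose (m + 1 - b) := hsymm ▸ hcard
  obtain ⟨𝓚, h𝓚, hc⟩ := exists_isInitSeg_card_eq (m := m + 1)
    (h𝓖.trans (Nat.choose_le_choose (m + 1 - b) (Nat.le_succ m)))
  have hsub : 𝓚ᶜˢ ⊆ powersetCard b univ := fun S hS => by
    have h2 := h𝓚.1 (mem_coe.2 (mem_compls.1 hS))
    have h3 := card_le_univ S
    rw [card_compl, Fintype.card_fin] at h2
    rw [Fintype.card_fin] at h3
    exact mem_powersetCard.2 ⟨subset_univ _, by omega⟩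
  refine ⟨𝓚ᶜˢ, hsub, by rw [card_compls, hc], ⟨Fin.last m, fun C hC => ?_⟩, ?_⟩
  · have := last_notMem_of_isInitSeg h𝓚 (hc ▸ h𝓖) (mem_compls.1 hC)
    simpa using this
  · have h1 := card_hitting_univ_add_card_shadow h hm
    have h2 := card_hitting_univ_add_card_shadow hsub hm
    have h3 := iterated_kk (k := m + 1 - b - a) (sized_compls_of_subset h)
      (show #𝓚 ≤ #𝓖ᶜˢ by rw [card_compls, hc]) h𝓚
    rw [compls_compls] at h2
    omega

theorem card_hitting_le_choose_of_le {m b : ℕ} {𝓖 : Finset (Finset (Fin m))}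
    (h : 𝓖 ⊆ powersetCard b univ) (hb : 1 ≤ b) (hm : b + b ≤ m)
    (hcard : (m - 1).choose (b - 1) ≤ #𝓖) :
    #(hitting b univ 𝓖) ≤ (m - 1).choose (b - 1) := by
  have h1 := card_hitting_univ_add_card_shadow h hm
  have hsymm : (m - 1).choose (m - b) = (m - 1).choose (b - 1) := by
    rw [← Nat.choose_symm (show b - 1 ≤ m - 1 by omega)]; congr 1; omega
  -- With `k = m - 1` at least `(m - 1).choose b` of the `b`-sets fail to be covers; Pascal's rule
  -- leaves the claimed bound.
  have h2 := kruskal_katona_lovasz_form (i := m - b - b) (k := m - 1) (by omega) (by omega)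
    (by omega) (sized_compls_of_subset h) (by rw [card_compls, hsymm]; exact hcard)
  rw [show m - b - (m - b - b) = b by omega] at h2
  obtain ⟨m, rfl⟩ : ∃ k, m = k + 1 := ⟨m - 1, by omega⟩
  obtain ⟨b, rfl⟩ : ∃ k, b = k + 1 := ⟨b - 1, by omega⟩
  rw [Nat.choose_succ_succ'] at h1
  simp only [Nat.add_sub_cancel] at h2 ⊢
  omega

end InitialSegments

/-! ### The boundary case of equal set sizes -/

section CrossIntersecting

open Finset

variable {α : Type*} [DecidableEq α]

theorem card_memberSubfamily_eq_card_filter (x : α) (𝓖 : Finset (Finset α)) :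
    #(𝓖.memberSubfamily x) = #{G ∈ 𝓖 | x ∈ G} := by
  have h1 := card_memberSubfamily_add_card_nonMemberSubfamily x 𝓖
  have h2 := card_filter_add_card_filter_not (s := 𝓖) (fun G => x ∈ G)
  rw [Finset.nonMemberSubfamily] at h1
  omega

/-- If every element of `S` lies in at most one member of `𝓖`, and every member of `𝓖` has at
least `c` elements in `S`, then `𝓖` is small. -/
theorem card_mul_le_of_memberSubfamily_le_one {c : ℕ} {S : Finset α} {𝓖 : Finset (Finset α)}
    (hc : ∀ G ∈ 𝓖, c ≤ #(S ∩ G)) (hS : ∀ x ∈ S, #(𝓖.memberSubfamily x) ≤ 1) : #𝓖 * c ≤ #S := by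
  rw [← mul_one #S]
  refine card_mul_le_card_mul (fun (G : Finset α) (x : α) => x ∈ G) (fun G hG => ?_)
    (fun x hx => ?_)
  · rw [bipartiteAbove, filter_mem_eq_inter]
    exact hc G hG
  · rw [bipartiteBelow, ← card_memberSubfamily_eq_card_filter]
    exact hS x hx

theorem coversLarge_one {U : Finset α} {𝓖 : Finset (Finset α)} (h : 𝓖.Nonempty) :
    CoversLarge 1 U 𝓖 := by
  intro S _ hc
  obtain ⟨G, hG⟩ := h
  exact card_pos.2 ((hc G hG).mono inter_subset_left)

theorem card_inter_le_of_subset_powersetCard {b : ℕ} {U : Finset α} {𝓖 : Finset (Finset α)}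
    (h : 𝓖 ⊆ powersetCard b U) (V : Finset α) : ∀ G ∈ 𝓖, #(G ∩ V) ≤ b := fun _ hG =>
  (card_le_card inter_subset_left).trans (mem_powersetCard.1 (h hG)).2.le

/-- A second member of `𝓗` excludes the covers of the first one that avoid it. -/
theorem card_hitting_add_choose_le {b c a : ℕ} {U : Finset α} {𝓗 : Finset (Finset α)}
    (h : 𝓗 ⊆ powersetCard c U) (hcb : c ≤ b) (h1 : 1 < #𝓗) :
    #(hitting (a + 1) U 𝓗) + (#U - c - 1).choose a ≤ hitCount b 1 c #U (a + 1) := by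
  obtain ⟨G₁, hG₁, G₂, hG₂, hne⟩ := one_lt_card.1 h1
  have m1 := mem_powersetCard.1 (h hG₁)
  have m2 := mem_powersetCard.1 (h hG₂)
  obtain ⟨u, hu1, hu2⟩ : ∃ u ∈ G₁, u ∉ G₂ := by
    by_contra hcon
    push Not at hcon
    exact hne (eq_of_subset_of_card_le hcon (by omega))
  have hle : #(hitting (a + 1) U {G₁}) ≤ hitCount b 1 c #U (a + 1) :=
    card_hitting_le_of_mem (card_hitting_le 0) (C := G₁)
      (fun G hG => (card_le_card inter_subset_left).trans (by
        rw [mem_singleton.1 hG]; omega)) (coversLarge_one (singleton_nonempty _))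
      (mem_singleton_self _) ((card_le_card inter_subset_left).trans m1.2.le)
  have hu : ∀ A ∈ powersetCard a ((U \ G₂).erase u), u ∉ A := fun A hA hu =>
    (mem_erase.1 ((mem_powersetCard.1 hA).1 hu)).1 rfl
  have hcard : #((powersetCard a ((U \ G₂).erase u)).image (insert u)) =
      (#U - c - 1).choose a := by
    rw [card_image_of_injOn, card_powersetCard, card_erase_of_mem
      (mem_sdiff.2 ⟨m1.1 hu1, hu2⟩), card_sdiff_of_subset m2.1, m2.2]
    intro A hA B hB hAB
    rw [← erase_insert (hu A hA), ← erase_insert (hu B hB)]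
    exact congrArg (fun S => S.erase u) hAB
  refine le_trans ?_ hle
  rw [← hcard, ← card_union_of_disjoint]
  · refine card_le_card (union_subset (hitting_subset_of_subset (by simpa using hG₁)) ?_)
    intro A hA
    obtain ⟨B, hB, rfl⟩ := mem_image.1 hA
    have hB' := mem_powersetCard.1 hB
    refine mem_hitting.2 ⟨⟨insert_subset (m1.1 hu1)
      (hB'.1.trans ((erase_subset _ _).trans sdiff_subset)), ?_⟩, fun G hG => ?_⟩
    · rw [card_insert_of_notMem (hu B hB), hB'.2]
    · rw [mem_singleton.1 hG]
      exact inter_nonempty_iff.2 ⟨u, mem_insert_self _ _, hu1⟩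
  · rw [disjoint_right]
    intro A hA hA'
    obtain ⟨B, hB, rfl⟩ := mem_image.1 hA
    obtain ⟨y, hy, hy2⟩ := inter_nonempty_iff.1 ((mem_hitting.1 hA').2 G₂ hG₂)
    rcases mem_insert.1 hy with rfl | hy
    · exact hu2 hy2
    · exact (mem_sdiff.1 (mem_of_mem_erase ((mem_powersetCard.1 hB).1 hy))).2 hy2

/-- The boundary case `t = 1`, `a = c + 1` of `card_eq_one_of_hitting_union_eq`. -/
theorem card_eq_one_of_hitting_union_eq_succ {b c : ℕ} {U : Finset α} {𝓖 𝓗 : Finset (Finset α)}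
    (hb : ∀ G ∈ 𝓖, #(G ∩ U) ≤ b) (hτ : CoversLarge 1 U 𝓖) (h𝓗 : 𝓗 ⊆ powersetCard c U)
    (hne : 𝓗.Nonempty) (hc : 2 ≤ c) (hcb : c < b) (hn : c + 1 + c < #U)
    (heq : #(hitting (c + 1) U (𝓖 ∪ 𝓗)) + #𝓗 = hitCount b 1 c #U (c + 1) + 1) : #𝓗 = 1 := by
  have hone : ∀ x ∈ U, #(𝓗.memberSubfamily x) ≤ 1 := by
    intro x hxU
    by_contra hx
    have hpos : (𝓗.memberSubfamily x).Nonempty := card_pos.1 (by omega)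
    obtain ⟨m, hm⟩ : ∃ m, #U = m + 1 := ⟨#U - 1, by omega⟩
    have hm' : #(U.erase x) = m := by rw [card_erase_of_mem hxU, hm]; rfl
    obtain ⟨d, rfl⟩ : ∃ d, c = d + 1 := ⟨c - 1, by omega⟩
    have h1 := card_hitting_union_add_card_le_hitCount 0 (d + 1) (d + 1) (U.erase x)
      (𝓖.nonMemberSubfamily x) (𝓗.nonMemberSubfamily x)
      (card_inter_erase_le_nonMember hb x) (hτ.nonMemberSubfamily hxU)
      (nonMemberSubfamily_subset_powersetCard h𝓗 x) hcb (by omega) (by omega)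
    have h2 := card_hitting_union_add_card_le (card_inter_erase_le hb x) (hτ.erase x)
      (memberSubfamily_subset_powersetCard h𝓗 x) hpos (by omega)
      (show d + 0 + 1 ≤ d + 1 + 1 by omega) (by omega)
    have h3 := card_le_card (hitting_erase_union_subset (a := d + 1 + 1) (U := U) 𝓖 𝓗 x)
    have h4 := card_memberSubfamily_add_card_nonMemberSubfamily x 𝓗
    rw [card_hitting_succ _ _ hxU, nonMemberSubfamily_union_eq, hm, hitCount_succ_succ] at heq
    -- Passing to traces lowers `c` but not the cover size, so the boundary case is left and the
    -- general equality lemma applies.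
    have h5 := card_eq_one_of_hitting_union_eq (card_inter_erase_le hb x) (hτ.erase x)
      (memberSubfamily_subset_powersetCard h𝓗 x) hpos (by omega)
      (show d + 0 + 1 ≤ d + 1 + 1 by omega) (by omega) (by omega)
      (by rw [hm'] at h1 h2 ⊢; omega)
    omega
  have hmat : #𝓗 * c ≤ #U := card_mul_le_of_memberSubfamily_le_one (fun H hH => by
    have := mem_powersetCard.1 (h𝓗 hH)
    rw [inter_eq_right.2 this.1, this.2]) hone
  have hpos := card_pos.2 hne
  by_contra hne1
  have h1 := card_hitting_add_choose_le (a := c) h𝓗 hcb.le (by omega)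
  have h2 := card_le_card (hitting_subset_of_subset (a := c + 1) (U := U)
    (subset_union_right : 𝓗 ⊆ 𝓖 ∪ 𝓗))
  -- A second member costs at least `#U - c - 1` covers, so equality needs `#𝓗 ≥ #U - c`. But `2 ≤
  -- c` gives `#𝓗 ≤ #U / 2`, against `2 * c + 1 < #U`. With `c = b - 1` this is where `(2, 2)` is
  -- excluded.
  have h3 := le_choose_of_pos_of_lt (show 1 ≤ c by omega) (show c < #U - c - 1 by omega)
  have h4 := Nat.mul_le_mul_left #𝓗 hc
  omega

/-- Two families of `b`-sets, the smaller one being `𝓖`. -/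
theorem card_hitting_add_card_le_of_small {m b : ℕ} {𝓖 : Finset (Finset (Fin m))}
    (h : 𝓖 ⊆ powersetCard b univ) (hne : 𝓖.Nonempty) (hb : 1 ≤ b) (hm : b + b ≤ m)
    (hcard : #𝓖 ≤ (m - 1).choose (b - 1)) :
    #(hitting b univ 𝓖) + #𝓖 ≤ hitCount b 1 b m b + 1 ∧
      (b + b < m → 3 ≤ b → #(hitting b univ 𝓖) + #𝓖 = hitCount b 1 b m b + 1 → #𝓖 = 1) := by
  obtain ⟨𝓔, h𝓔, hc, ⟨x, hx⟩, hle⟩ := exists_star_hitting_ge (a := b) h hb hm hcard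
  obtain ⟨d, rfl⟩ : ∃ d, b = d + 1 := ⟨b - 1, by omega⟩
  obtain ⟨m, rfl⟩ : ∃ k, m = k + 1 := ⟨m - 1, by omega⟩
  have hne' : 𝓔.Nonempty := card_pos.1 (hc ▸ card_pos.2 hne)
  obtain ⟨E, hE⟩ := hne'
  have hm' : #((univ : Finset (Fin (m + 1))).erase x) = m := by
    rw [card_erase_of_mem (mem_univ x), card_univ, Fintype.card_fin]; rfl
  have he : 𝓔.nonMemberSubfamily x = ∅ := by
    ext S; simp only [mem_nonMemberSubfamily, notMem_empty, iff_false]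
    exact fun hS => hS.2 (hx S hS.1)
  have h4 := card_memberSubfamily_add_card_nonMemberSubfamily x 𝓔
  rw [he, card_empty] at h4
  have h1 : #(hitting d ((univ : Finset (Fin (m + 1))).erase x) (𝓔.nonMemberSubfamily x)) ≤
      m.choose d :=
    (card_le_card (hitting_subset _ _ _)).trans_eq (by rw [card_powersetCard, hm'])
  have hb' : ∀ G ∈ 𝓔, #(G ∩ univ.erase x) ≤ d + 1 := card_inter_le_of_subset_powersetCard h𝓔 _
  have hτ : CoversLarge 1 (univ.erase x) 𝓔 := coversLarge_one ⟨E, hE⟩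
  have hsub := memberSubfamily_subset_powersetCard h𝓔 x
  have hmne := memberSubfamily_nonempty hE (hx E hE)
  -- The star supplies both the large-cover family and, through its traces at the centre, the
  -- charged one.
  have h2 := card_hitting_union_add_card_le hb' hτ hsub hmne (Nat.lt_succ_self d)
    (show d + 0 + 1 ≤ d + 1 by omega) (by omega)
  have h3 := card_le_card (hitting_erase_union_subset (a := d + 1) (U := univ) 𝓔 𝓔 x)
  rw [union_self] at h3
  have h5 := card_hitting_succ d 𝓔 (mem_univ x)
  rw [hitCount_succ_succ, hitCount_zero]
  refine ⟨by rw [hm'] at h2; omega, fun hlt hb3 heq => ?_⟩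
  rw [← hc, ← h4]
  refine card_eq_one_of_hitting_union_eq_succ hb' hτ hsub hmne (by omega) (Nat.lt_succ_self d)
    (by omega) ?_
  rw [hm'] at h2 ⊢
  change _ = hitCount (d + 1) (0 + 1) d m (d + 1) + 1
  omega

/-- Two non-empty cross-intersecting families of `b`-sets. -/
theorem card_add_card_le_of_eq_size {m b : ℕ} {𝓕 𝓖 : Finset (Finset (Fin m))}
    (h𝓖 : 𝓖 ⊆ powersetCard b univ) (h𝓕 : 𝓕 ⊆ hitting b univ 𝓖) (hne : 𝓖.Nonempty)
    (hne' : 𝓕.Nonempty) (hb : 1 ≤ b) (hm : b + b ≤ m) :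
    #𝓕 + #𝓖 ≤ hitCount b 1 b m b + 1 ∧
      (b + b < m → 3 ≤ b → #𝓕 + #𝓖 = hitCount b 1 b m b + 1 → #𝓖 = 1 ∨ #𝓕 = 1) := by
  have hF := card_le_card h𝓕
  -- If `𝓖` exceeds the size of a full star, `𝓕` cannot, and the roles are exchanged.
  rcases le_total #𝓖 ((m - 1).choose (b - 1)) with hc | hc
  · have := card_hitting_add_card_le_of_small h𝓖 hne hb hm hc
    exact ⟨by omega, fun h1 h2 h3 => Or.inl (this.2 h1 h2 (by omega))⟩
  · have h1 := card_hitting_le_choose_of_le h𝓖 hb hm hc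
    have h2 : 𝓕 ⊆ powersetCard b univ := h𝓕.trans (hitting_subset _ _ _)
    have h3 : 𝓖 ⊆ hitting b univ 𝓕 := fun G hG =>
      mem_hitting.2 ⟨mem_powersetCard.1 (h𝓖 hG), fun F hF => by
        rw [inter_comm]; exact (mem_hitting.1 (h𝓕 hF)).2 G hG⟩
    have h4 := card_le_card h3
    have := card_hitting_add_card_le_of_small h2 hne' hb hm (by omega)
    exact ⟨by omega, fun h5 h6 h7 => Or.inr (this.2 h5 h6 (by omega))⟩

/-- Transports the Kruskal–Katona bound from `Fin #U` to an arbitrary ground set, since the main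
induction deletes points. -/
theorem card_hitting_add_card_le_of_eq_size {b : ℕ} {U : Finset α} {𝓖 : Finset (Finset α)}
    (h𝓖 : 𝓖 ⊆ powersetCard b U) (hne : 𝓖.Nonempty) (hne' : (hitting b U 𝓖).Nonempty)
    (hb : 1 ≤ b) (hU : b + b ≤ #U) :
    #(hitting b U 𝓖) + #𝓖 ≤ hitCount b 1 b #U b + 1 := by
  set e : Fin #U ↪ α := U.equivFin.symm.toEmbedding.trans (Function.Embedding.subtype _) with he
  have hrange : univ.map e = U := by
    ext y
    simp only [he, mem_map, mem_univ, true_and, Function.Embedding.trans_apply,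
      Equiv.toEmbedding_apply, Function.Embedding.subtype_apply]
    exact ⟨fun ⟨i, hi⟩ => hi ▸ (U.equivFin.symm i).2, fun hy => ⟨U.equivFin ⟨y, hy⟩, by simp⟩⟩
  have key : ∀ 𝓐 : Finset (Finset α), 𝓐 ⊆ powersetCard b U → ∃ 𝓑 ⊆ powersetCard b univ,
      𝓑.map (mapEmbedding e).toEmbedding = 𝓐 := by
    intro 𝓐 h𝓐
    have h1 : powersetCard b U = (powersetCard b univ).map (mapEmbedding e).toEmbedding := by
      rw [← powersetCard_map, hrange]
    rw [h1, subset_map_iff] at h𝓐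
    obtain ⟨𝓑, h2, h3⟩ := h𝓐
    exact ⟨𝓑, h2, h3.symm⟩
  obtain ⟨𝓑, h1, h2⟩ := key 𝓖 h𝓖
  obtain ⟨𝓐, h3, h4⟩ := key (hitting b U 𝓖) (hitting_subset _ _ _)
  have h5 : 𝓐 ⊆ hitting b univ 𝓑 := by
    intro A hA
    refine mem_hitting.2 ⟨mem_powersetCard.1 (h3 hA), fun B hB => ?_⟩
    have h6 : A.map e ∈ hitting b U 𝓖 := h4 ▸ mem_map.2 ⟨A, hA, rfl⟩
    have h7 : B.map e ∈ 𝓖 := h2 ▸ mem_map.2 ⟨B, hB, rfl⟩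
    have h8 := (mem_hitting.1 h6).2 _ h7
    rwa [← map_inter, map_nonempty] at h8
  have h6 := (card_add_card_le_of_eq_size h1 h5 (by rwa [← h2, map_nonempty] at hne)
    (by rwa [← h4, map_nonempty] at hne') hb hU).1
  have h7 : #(hitting b U 𝓖) = #𝓐 := by rw [← h4, card_map]
  have h8 : #𝓖 = #𝓑 := by rw [← h2, card_map]
  rwa [h7, h8]

end CrossIntersecting

/-! ### The induction on the covering number and the equality case -/

section Main

open Finset

variable {α : Type*} [DecidableEq α]

/-- The contribution of the covers avoiding `x` and the members of `𝓖` through `x`. -/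
theorem card_hitting_erase_add_card_member_le {b t a : ℕ} {U G : Finset α}
    {𝓖 : Finset (Finset α)} {x : α} (h𝓖 : 𝓖 ⊆ powersetCard (b + 1) U)
    (hτ : CoversLarge (t + 1) U 𝓖) (hab : b + 1 + t ≤ a) (hU : a + (b + 1) ≤ #U) (hG : G ∈ 𝓖)
    (hx : x ∈ G) :
    #(hitting a (U.erase x) 𝓖) + #(𝓖.memberSubfamily x) ≤
        hitCount (b + 1) (t + 1) b (#U - 1) a + 1 ∧
      (a + (b + 1) < #U → (t = 0 → b + 1 < a) →
        #(hitting a (U.erase x) 𝓖) + #(𝓖.memberSubfamily x) =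
          hitCount (b + 1) (t + 1) b (#U - 1) a + 1 → #(𝓖.memberSubfamily x) = 1) := by
  have hxU := (mem_powersetCard.1 (h𝓖 hG)).1 hx
  have hm : #(U.erase x) = #U - 1 := card_erase_of_mem hxU
  have hb : ∀ G ∈ 𝓖, #(G ∩ U.erase x) ≤ b + 1 := card_inter_le_of_subset_powersetCard h𝓖 _
  have hsub := memberSubfamily_subset_powersetCard h𝓖 x
  have hne := memberSubfamily_nonempty hG hx
  have h1 := card_hitting_union_add_card_le hb (hτ.erase x) hsub hne (Nat.lt_succ_self b)
    (show b + t + 1 ≤ a by omega) (by omega)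
  have h2 := card_le_card (hitting_erase_union_subset (a := a) (U := U) 𝓖 𝓖 x)
  rw [union_self] at h2
  refine ⟨by rw [hm] at h1; omega, fun hlt h0 heq => ?_⟩
  refine card_eq_one_of_hitting_union_eq hb (hτ.erase x) hsub hne (Nat.lt_succ_self b)
    (show b + t + 1 ≤ a by omega) (by omega) h0 ?_
  rw [hm] at h1 ⊢
  omega

theorem erase_mem_hitting_nonMember {a : ℕ} {U A : Finset α} {𝓖 : Finset (Finset α)} {x : α}
    (hA : A ∈ hitting (a + 1) U 𝓖) (hx : x ∈ A) :
    A.erase x ∈ hitting a (U.erase x) (𝓖.nonMemberSubfamily x) := by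
  rw [← memberSubfamily_hitting_succ a 𝓖 ((mem_hitting.1 hA).1.1 hx), mem_memberSubfamily,
    insert_erase hx]
  exact ⟨hA, notMem_erase x A⟩

/-- The bound for `b`-sets whose covers have more than `t` elements and their `a`-covers. -/
theorem card_hitting_add_card_le {b t a : ℕ} {U : Finset α} {𝓖 : Finset (Finset α)}
    (h𝓖 : 𝓖 ⊆ powersetCard b U) (hτ : CoversLarge (t + 1) U 𝓖) (hne : (hitting a U 𝓖).Nonempty)
    (hb : 1 ≤ b) (hab : b + t ≤ a) (hU : a + b ≤ #U) :
    #(hitting a U 𝓖) + #𝓖 ≤ hitCount b (t + 1) b #U a + (t + 1) := by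
  induction t generalizing a U 𝓖 with
  | zero =>
    obtain ⟨G, hG⟩ := hτ.nonempty
    rcases Nat.eq_or_lt_of_le hab with rfl | hlt
    · exact card_hitting_add_card_le_of_eq_size h𝓖 ⟨G, hG⟩ hne hb hU
    obtain ⟨b, rfl⟩ : ∃ k, b = k + 1 := ⟨b - 1, by omega⟩
    have hG' := mem_powersetCard.1 (h𝓖 hG)
    obtain ⟨x, hx⟩ : G.Nonempty := card_pos.1 (by omega)
    obtain ⟨a, rfl⟩ : ∃ k, a = k + 1 := ⟨a - 1, by omega⟩
    obtain ⟨m, hm⟩ : ∃ k, #U = k + 1 := ⟨#U - 1, by omega⟩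
    have hm' : #(U.erase x) = m := by rw [card_erase_of_mem (hG'.1 hx), hm]; rfl
    have h1 := (card_hitting_erase_add_card_member_le h𝓖 hτ hab hU hG hx).1
    have h2 := card_hitting_add_card_le_choose (a := a)
      (nonMemberSubfamily_subset_powersetCard h𝓖 x) (by omega) (by omega)
    have h3 := card_memberSubfamily_add_card_nonMemberSubfamily x 𝓖
    rw [card_hitting_succ a 𝓖 (hG'.1 hx), hm, hitCount_succ_succ, hitCount_zero]
    rw [hm, Nat.add_sub_cancel] at h1
    rw [hm'] at h2
    omega
  | succ t ih =>
    obtain ⟨G, hG⟩ := hτ.nonempty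
    obtain ⟨A, hA⟩ := hne
    -- Taking `x` inside a cover keeps the covers in the link nonempty, which the equal-size base
    -- case needs.
    obtain ⟨x, hxA, hx⟩ := inter_nonempty_iff.1 ((mem_hitting.1 hA).2 G hG)
    obtain ⟨b, rfl⟩ : ∃ k, b = k + 1 := ⟨b - 1, by omega⟩
    obtain ⟨a, rfl⟩ : ∃ k, a = k + 1 := ⟨a - 1, by omega⟩
    obtain ⟨m, hm⟩ : ∃ k, #U = k + 1 := ⟨#U - 1, by omega⟩
    have hxU := (mem_powersetCard.1 (h𝓖 hG)).1 hx
    have hm' : #(U.erase x) = m := by rw [card_erase_of_mem hxU, hm]; rfl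
    have h1 := (card_hitting_erase_add_card_member_le h𝓖 hτ hab hU hG hx).1
    have h2 := ih (nonMemberSubfamily_subset_powersetCard h𝓖 x) (hτ.nonMemberSubfamily hxU)
      ⟨_, erase_mem_hitting_nonMember hA hxA⟩ (by omega) (by omega)
    have h3 := card_memberSubfamily_add_card_nonMemberSubfamily x 𝓖
    rw [card_hitting_succ a 𝓖 hxU, hm, hitCount_succ_succ]
    rw [hm, Nat.add_sub_cancel] at h1
    rw [hm'] at h2
    omega

/-- In the case of equality, an element of a member of `𝓖` and of an `a`-cover lies in one member
only, and equality holds for the members and covers in the link. -/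
theorem card_member_eq_one_of_eq {b t a : ℕ} {U G A : Finset α} {𝓖 : Finset (Finset α)} {x : α}
    (h𝓖 : 𝓖 ⊆ powersetCard b U) (hτ : CoversLarge (t + 1) U 𝓖) (hb : 1 ≤ b) (hab : b + t ≤ a + 1)
    (hU : a + 1 + b < #U) (h0 : t = 0 → b ≤ a)
    (heq : #(hitting (a + 1) U 𝓖) + #𝓖 = hitCount b (t + 1) b #U (a + 1) + (t + 1))
    (hG : G ∈ 𝓖) (hxG : x ∈ G) (hA : A ∈ hitting (a + 1) U 𝓖) (hxA : x ∈ A) :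
    #(𝓖.memberSubfamily x) = 1 ∧
      #(hitting a (U.erase x) (𝓖.nonMemberSubfamily x)) + #(𝓖.nonMemberSubfamily x) =
        hitCount b t b (#U - 1) a + t := by
  obtain ⟨b, rfl⟩ : ∃ k, b = k + 1 := ⟨b - 1, by omega⟩
  obtain ⟨m, hm⟩ : ∃ k, #U = k + 1 := ⟨#U - 1, by omega⟩
  have hxU := (mem_powersetCard.1 (h𝓖 hG)).1 hxG
  have hm' : #(U.erase x) = m := by rw [card_erase_of_mem hxU, hm]; rfl
  have h1 := card_hitting_erase_add_card_member_le h𝓖 hτ hab hU.le hG hxG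
  have h2 : #(hitting a (U.erase x) (𝓖.nonMemberSubfamily x)) + #(𝓖.nonMemberSubfamily x) ≤
      hitCount (b + 1) t (b + 1) m a + t := by
    rcases t with _ | t
    · rw [hitCount_zero, ← hm']
      exact card_hitting_add_card_le_choose (nonMemberSubfamily_subset_powersetCard h𝓖 x)
        (h0 rfl) (by omega)
    · rw [← hm']
      exact card_hitting_add_card_le (nonMemberSubfamily_subset_powersetCard h𝓖 x)
        (hτ.nonMemberSubfamily hxU) ⟨_, erase_mem_hitting_nonMember hA hxA⟩ (by omega) (by omega)
        (by omega)
  have h3 := card_memberSubfamily_add_card_nonMemberSubfamily x 𝓖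
  rw [card_hitting_succ a 𝓖 hxU, hm, hitCount_succ_succ] at heq
  rw [hm, Nat.add_sub_cancel] at h1 ⊢
  exact ⟨h1.2 (by omega) (by omega) (by omega), by omega⟩

/-- Every member meets a fixed cover, and each of the `a` elements of that cover lies in at most one
member. -/
theorem card_le_of_eq {b t a : ℕ} {U : Finset α} {𝓖 : Finset (Finset α)}
    (h𝓖 : 𝓖 ⊆ powersetCard b U) (hτ : CoversLarge (t + 1) U 𝓖) (hne : (hitting a U 𝓖).Nonempty)
    (hb : 1 ≤ b) (hab : b + t ≤ a) (hU : a + b < #U) (h0 : t = 0 → b < a)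
    (heq : #(hitting a U 𝓖) + #𝓖 = hitCount b (t + 1) b #U a + (t + 1)) : #𝓖 ≤ a := by
  obtain ⟨A, hA⟩ := hne
  obtain ⟨a, rfl⟩ : ∃ k, a = k + 1 := ⟨a - 1, by omega⟩
  have hA' := mem_hitting.1 hA
  rw [← hA'.1.2, ← mul_one #𝓖]
  refine card_mul_le_of_memberSubfamily_le_one (fun G hG => card_pos.2 (hA'.2 G hG))
    fun x hx => ?_
  by_contra hcon
  obtain ⟨H, hH⟩ : (𝓖.memberSubfamily x).Nonempty := card_pos.1 (by omega)
  have := (card_member_eq_one_of_eq h𝓖 hτ hb hab hU (by omega) heq (mem_memberSubfamily.1 hH).1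
    (mem_insert_self x H) hA hx).1
  omega

/-- The descent can end at covering number one with equal sizes, where equality alone is not enough.
The bound `#𝓖 ≤ a` survives each step, since one member and one element are removed, and it settles
that end. -/
theorem card_eq_of_eq_of_card_le {b t a : ℕ} {U : Finset α} {𝓖 : Finset (Finset α)}
    (h𝓖 : 𝓖 ⊆ powersetCard b U) (hτ : CoversLarge (t + 1) U 𝓖) (hne : (hitting a U 𝓖).Nonempty)
    (hb : 2 ≤ b) (hab : b + t ≤ a) (hU : a + b < #U) (hcard : #𝓖 ≤ a)
    (heq : #(hitting a U 𝓖) + #𝓖 = hitCount b (t + 1) b #U a + (t + 1)) : #𝓖 = t + 1 := by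
  induction t generalizing a U 𝓖 with
  | zero =>
    have hpos := card_pos.2 hτ.nonempty
    by_contra hne1
    obtain ⟨a, rfl⟩ : ∃ k, a = k + 1 := ⟨a - 1, by omega⟩
    have h1 := card_hitting_add_choose_le (a := a) h𝓖 le_rfl (by omega)
    -- Two members would lose at least `#U - b - 1 > a` covers, more than the at most `a` surplus
    -- members could make up for.
    have h2 := le_choose_of_pos_of_lt (show 1 ≤ a by omega) (show a < #U - b - 1 by omega)
    simp only [Nat.zero_add] at heq
    omega
  | succ t ih =>
    obtain ⟨G, hG⟩ := hτ.nonempty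
    obtain ⟨A, hA⟩ := hne
    obtain ⟨x, hxA, hx⟩ := inter_nonempty_iff.1 ((mem_hitting.1 hA).2 G hG)
    obtain ⟨a, rfl⟩ : ∃ k, a = k + 1 := ⟨a - 1, by omega⟩
    have hxU := (mem_powersetCard.1 (h𝓖 hG)).1 hx
    have hm : #(U.erase x) = #U - 1 := card_erase_of_mem hxU
    obtain ⟨h1, h2⟩ := card_member_eq_one_of_eq h𝓖 hτ (by omega) hab hU (by omega) heq hG hx hA hxA
    have h3 := card_memberSubfamily_add_card_nonMemberSubfamily x 𝓖
    rw [← hm] at h2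
    have h4 := ih (nonMemberSubfamily_subset_powersetCard h𝓖 x) (hτ.nonMemberSubfamily hxU)
      ⟨_, erase_mem_hitting_nonMember hA hxA⟩ (by omega) (by omega) (by omega) h2
    omega

/-- A family of `t` sets all of whose covers have at least `t` elements is pairwise disjoint. -/
theorem CoversLarge.pairwise_disjoint {t b : ℕ} {U : Finset α} {𝓖 : Finset (Finset α)}
    (hτ : CoversLarge t U 𝓖) (hcard : #𝓖 = t) (h𝓖 : 𝓖 ⊆ powersetCard b U) (hb : 1 ≤ b)
    {G H : Finset α} (hG : G ∈ 𝓖) (hH : H ∈ 𝓖) (hne : G ≠ H) : Disjoint G H := by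
  by_contra hd
  obtain ⟨x, hxG, hxH⟩ := not_disjoint_iff.1 hd
  have hmem : ∀ S ∈ 𝓖, ∃ y, y ∈ S := fun S hS =>
    card_pos.1 (by rw [(mem_powersetCard.1 (h𝓖 hS)).2]; omega)
  have : Nonempty α := ⟨x⟩
  choose! f hf using hmem
  -- One point shared by `G` and `H` and one from each other member: a cover with at most `t - 1`
  -- elements.
  set S := insert x (((𝓖.erase G).erase H).image f) with hS
  have h1 : S ⊆ U := by
    refine insert_subset ((mem_powersetCard.1 (h𝓖 hG)).1 hxG) (image_subset_iff.2 fun T hT => ?_)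
    have hT' := mem_of_mem_erase (mem_of_mem_erase hT)
    exact (mem_powersetCard.1 (h𝓖 hT')).1 (hf T hT')
  have h2 := hτ S h1 fun T hT => by
    rw [inter_nonempty_iff]
    by_cases hTG : T = G
    · exact ⟨x, mem_insert_self _ _, hTG ▸ hxG⟩
    by_cases hTH : T = H
    · exact ⟨x, mem_insert_self _ _, hTH ▸ hxH⟩
    · exact ⟨f T, mem_insert_of_mem (mem_image_of_mem f
        (mem_erase.2 ⟨hTH, mem_erase.2 ⟨hTG, hT⟩⟩)), hf T hT⟩
  have h3 : #S ≤ _ := (card_insert_le x (((𝓖.erase G).erase H).image f)).trans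
    (Nat.add_le_add_right card_image_le 1)
  have h4 := card_erase_of_mem hG
  have h5 := card_erase_of_mem (mem_erase.2 ⟨hne.symm, hH⟩)
  have h6 := card_pos.2 ⟨H, mem_erase.2 ⟨hne.symm, hH⟩⟩
  omega

/-- The number of `a`-covers of pairwise disjoint `b`-sets. -/
theorem card_hitting_of_disjoint {b : ℕ} (a : ℕ) {𝓑 : Finset (Finset α)} {U : Finset α}
    (h𝓑 : 𝓑 ⊆ powersetCard b U) (hd : ∀ G ∈ 𝓑, ∀ H ∈ 𝓑, G ≠ H → Disjoint G H) :
    (#(hitting a U 𝓑) : ℤ) = ∑ i ∈ range (#𝓑 + 1),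
      (-1 : ℤ) ^ i * ((#𝓑).choose i : ℤ) * ((#U - i * b).choose a : ℤ) := by
  induction 𝓑 using Finset.induction_on generalizing U with
  | empty => simp [hitting]
  | insert B 𝓑 hB ih =>
    have hB' := mem_powersetCard.1 (h𝓑 (mem_insert_self _ _))
    have hsub : 𝓑 ⊆ powersetCard b U := (subset_insert _ _).trans h𝓑
    have hd' : ∀ G ∈ 𝓑, ∀ H ∈ 𝓑, G ≠ H → Disjoint G H := fun G hG H hH =>
      hd G (mem_insert_of_mem hG) H (mem_insert_of_mem hH)
    have hsub' : 𝓑 ⊆ powersetCard b (U \ B) := fun G hG => by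
      have hG' := mem_powersetCard.1 (hsub hG)
      exact mem_powersetCard.2 ⟨subset_sdiff.2 ⟨hG'.1, hd G (mem_insert_of_mem hG) B
        (mem_insert_self _ _) fun h => hB (h ▸ hG)⟩, hG'.2⟩
    have h1 := card_filter_add_card_filter_not (s := hitting a U 𝓑) (fun A => (A ∩ B).Nonempty)
    have h2 : {A ∈ hitting a U 𝓑 | (A ∩ B).Nonempty} = hitting a U (insert B 𝓑) := by
      ext A
      simp only [mem_filter, mem_hitting, mem_insert, forall_eq_or_imp]
      tauto
    have h3 : {A ∈ hitting a U 𝓑 | ¬ (A ∩ B).Nonempty} = hitting a (U \ B) 𝓑 := by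
      ext A
      simp only [mem_filter, mem_hitting, not_nonempty_iff_eq_empty, subset_sdiff,
        disjoint_iff_inter_eq_empty]
      tauto
    rw [h2, h3] at h1
    rw [card_insert_of_notMem hB, sum_alternating_choose_succ, ← ih hsub hd']
    have h4 := ih hsub' hd'
    rw [card_sdiff_of_subset hB'.1, hB'.2] at h4
    rw [← h4, ← h1]
    push_cast; ring

end Main

/-! ### The extremal family and the theorem -/

section Isomorphism

open Finset

theorem familyIso_refl {n : ℕ} (𝓐 : Multiset (Finset (Fin n))) : FamilyIso 𝓐 𝓐 :=
  ⟨Equiv.refl _, by simp⟩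

theorem filter_forall_inter_eq_hitting {n t : ℕ} (a : ℕ) (B : Fin t → Finset (Fin n)) :
    (powersetCard a univ).filter (fun A => ∀ i, (A ∩ B i).Nonempty) =
      hitting a univ (univ.image B) := by
  ext A
  simp [hitting]

theorem card_of_isoToExtremal {n t a b : ℕ} (hb : 1 ≤ b) {𝓐 : Multiset (Finset (Fin n))}
    (h : IsoToExtremal t a b 𝓐) :
    (𝓐.card : ℤ) = ∑ i ∈ range (t + 1), (-1 : ℤ) ^ i * (t.choose i : ℤ) *
      ((n - i * b).choose a : ℤ) + t := by
  obtain ⟨B, hcard, hdisj, σ, hσ⟩ := h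
  have hinj : Function.Injective B := fun i j hij => by
    by_contra hne
    have h1 := hdisj i j hne
    rw [hij, disjoint_self] at h1
    have h2 := hcard j
    rw [h1] at h2
    simp at h2
    omega
  have h1 : #(univ.image B) = t := by
    rw [card_image_of_injective _ hinj, card_univ, Fintype.card_fin]
  have h2 := card_hitting_of_disjoint (b := b) a (𝓑 := univ.image B) (U := univ)
    (fun S hS => by
      obtain ⟨i, -, rfl⟩ := mem_image.1 hS
      exact mem_powersetCard.2 ⟨subset_univ _, hcard i⟩)
    (fun G hG H hH hne => by
      obtain ⟨i, -, rfl⟩ := mem_image.1 hG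
      obtain ⟨j, -, rfl⟩ := mem_image.1 hH
      exact hdisj i j fun hij => hne (hij ▸ rfl))
  rw [h1, card_univ, Fintype.card_fin] at h2
  rw [← h2]
  have h3 := congrArg Multiset.card hσ
  rw [Multiset.card_map, extremalFamily, Multiset.card_add, filter_forall_inter_eq_hitting,
    card_val, card_val, h1] at h3
  rw [h3]
  push_cast; ring

/-- A disjoint family of `t` `b`-sets together with as many `a`-covers as possible is extremal. -/
theorem isoToExtremal_of_disjoint {n t a b : ℕ} {𝓕 𝓖 : Finset (Finset (Fin n))}
    (h𝓖 : 𝓖 ⊆ powersetCard b univ) (hcard : #𝓖 = t)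
    (hd : ∀ G ∈ 𝓖, ∀ H ∈ 𝓖, G ≠ H → Disjoint G H) (h𝓕 : 𝓕 ⊆ hitting a univ 𝓖)
    (hle : #(hitting a univ 𝓖) ≤ #𝓕) : IsoToExtremal t a b (𝓕.val + 𝓖.val) := by
  set e := (𝓖.equivFinOfCardEq hcard).symm with he
  have himage : univ.image (fun i => (e i : Finset (Fin n))) = 𝓖 := by
    ext S
    simp only [mem_image, mem_univ, true_and]
    exact ⟨fun ⟨i, hi⟩ => hi ▸ (e i).2, fun hS => ⟨e.symm ⟨S, hS⟩, by simp⟩⟩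
  refine ⟨fun i => (e i : Finset (Fin n)), fun i => (mem_powersetCard.1 (h𝓖 (e i).2)).2,
    fun i j hij => hd _ (e i).2 _ (e j).2 fun h => hij (e.injective (Subtype.ext h)), ?_⟩
  rw [extremalFamily, filter_forall_inter_eq_hitting, himage, ← eq_of_subset_of_card_le h𝓕 hle,
    add_comm]
  exact familyIso_refl _

theorem coversLarge_of_le_coveringNumber {n t : ℕ} {𝓖 : Finset (Finset (Fin n))}
    (h : t ≤ coveringNumber 𝓖) : CoversLarge t univ 𝓖 :=
  fun S _ hS => h.trans (Nat.sInf_le ⟨S, hS, rfl⟩)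

end Isomorphism

open Finset in
theorem mainTheorem1 (n a b t : ℕ) (ht : 1 ≤ t) (hb : 2 ≤ b) (hab : b + t - 1 ≤ a)
    (hn : max (a + b) (b * t) ≤ n)
    (𝓕 𝓖 : Finset (Finset (Fin n)))
    (h𝓕 : 𝓕 ⊆ Finset.powersetCard a Finset.univ)
    (h𝓖 : 𝓖 ⊆ Finset.powersetCard b Finset.univ)
    (hcross : CrossIntersecting 𝓕 𝓖)
    (hτ𝓕 : 1 ≤ coveringNumber 𝓕) (hτ𝓖 : t ≤ coveringNumber 𝓖) :
    (𝓕.card : ℤ) + (𝓖.card : ℤ) ≤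
        (n.choose a : ℤ)
          + ∑ i ∈ Finset.Icc 1 t, (-1 : ℤ) ^ i * (t.choose i : ℤ) * ((n - i * b).choose a : ℤ)
          + (t : ℤ) ∧
      (a + b < n →
        (IsoToExtremal t a b (𝓕.val + 𝓖.val) →
          (𝓕.card : ℤ) + (𝓖.card : ℤ) =
            (n.choose a : ℤ)
              + ∑ i ∈ Finset.Icc 1 t, (-1 : ℤ) ^ i * (t.choose i : ℤ) * ((n - i * b).choose a : ℤ)
              + (t : ℤ)) ∧
        (¬ (a = 2 ∧ b = 2) →
          (𝓕.card : ℤ) + (𝓖.card : ℤ) =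
            (n.choose a : ℤ)
              + ∑ i ∈ Finset.Icc 1 t, (-1 : ℤ) ^ i * (t.choose i : ℤ) * ((n - i * b).choose a : ℤ)
              + (t : ℤ) →
          IsoToExtremal t a b (𝓕.val + 𝓖.val))) := by
  have hsum : (n.choose a : ℤ)
      + ∑ i ∈ Finset.Icc 1 t, (-1 : ℤ) ^ i * (t.choose i : ℤ) * ((n - i * b).choose a : ℤ) =
      ∑ i ∈ range (t + 1), (-1 : ℤ) ^ i * (t.choose i : ℤ) * ((n - i * b).choose a : ℤ) := by
    rw [range_eq_Ico, sum_eq_sum_Ico_succ_bot (Nat.succ_pos t)]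
    simp only [Nat.zero_add, pow_zero, Nat.choose_zero_right, zero_mul, Nat.sub_zero, one_mul,
      Nat.cast_one]
    rfl
  have hn1 : a + b ≤ n := (le_max_left _ _).trans hn
  have hn2 : b * t ≤ n := (le_max_right _ _).trans hn
  obtain ⟨s, rfl⟩ : ∃ s, t = s + 1 := ⟨t - 1, by omega⟩
  rw [hsum, ← hitCount_eq_sum b (s + 1) n a hn2]
  have hcard : #(univ : Finset (Fin n)) = n := by rw [card_univ, Fintype.card_fin]
  have hτ := coversLarge_of_le_coveringNumber hτ𝓖
  have hτ' : CoversLarge 1 univ 𝓕 := coversLarge_of_le_coveringNumber hτ𝓕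
  have hFsub : 𝓕 ⊆ hitting a univ 𝓖 := fun F hF =>
    mem_hitting.2 ⟨mem_powersetCard.1 (h𝓕 hF), fun G hG => hcross F hF G hG⟩
  have hFne := hτ'.nonempty
  have hle := card_le_card hFsub
  have hbound := card_hitting_add_card_le h𝓖 hτ (hFne.mono hFsub) (by omega)
    (show b + s ≤ a by omega) (by omega)
  rw [hcard] at hbound
  refine ⟨by exact_mod_cast (by omega : #𝓕 + #𝓖 ≤ hitCount b (s + 1) b n a + (s + 1)),
    fun hlt => ⟨fun hiso => ?_, fun h22 heq => ?_⟩⟩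
  · rw [hitCount_eq_sum b (s + 1) n a hn2, ← card_of_isoToExtremal (by omega) hiso,
      Multiset.card_add, card_val, card_val]
    push_cast; rfl
  replace heq : #𝓕 + #𝓖 = hitCount b (s + 1) b n a + (s + 1) := by exact_mod_cast heq
  have hof : #𝓖 = s + 1 → IsoToExtremal (s + 1) a b (𝓕.val + 𝓖.val) := fun h =>
    isoToExtremal_of_disjoint h𝓖 h
      (fun _ hG _ hH hne => hτ.pairwise_disjoint h h𝓖 (by omega) hG hH hne) hFsub (by omega)
  by_cases h0 : s = 0 ∧ a = b
  · obtain ⟨rfl, rfl⟩ := h0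
    rcases (card_add_card_le_of_eq_size h𝓖 hFsub hτ.nonempty hFne (by omega) hn1).2 hlt (by omega)
      heq with h | h
    · exact hof h
    -- With equal sizes and `t = 1` the single set may be in `𝓕`; the union with multiplicity is
    -- symmetric, so exchanging the families gives the same extremal collection.
    · have hGsub : 𝓖 ⊆ hitting a univ 𝓕 := fun G hG =>
        mem_hitting.2 ⟨mem_powersetCard.1 (h𝓖 hG), fun F hF => by
          rw [inter_comm]; exact hcross F hF G hG⟩
      have hbound' := card_hitting_add_card_le h𝓕 hτ' (hτ.nonempty.mono hGsub) (by omega)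
        (show a + 0 ≤ a by omega) (by omega)
      rw [hcard] at hbound'
      rw [add_comm 𝓕.val]
      exact isoToExtremal_of_disjoint h𝓕 h
        (fun _ hG _ hH hne => hτ'.pairwise_disjoint h h𝓕 (by omega) hG hH hne) hGsub (by omega)
  · have heq' : #(hitting a univ 𝓖) + #𝓖 =
        hitCount b (s + 1) b #(univ : Finset (Fin n)) a + (s + 1) := by
      rw [hcard]; omega
    have h1 := card_le_of_eq h𝓖 hτ (hFne.mono hFsub) (by omega) (by omega) (by omega) (by omega)
      heq'
    exact hof (card_eq_of_eq_of_card_le h𝓖 hτ (hFne.mono hFsub) hb (by omega) (by omega) h1 heq')
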